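/- A strict partition is a finite strictly decreasing sequence $\lambda=(\lambda_1>\dots>\lambda_\ell)$ of positive integers (possibly empty), with $|\lambda|=\sum_i\lambda_i$, $\ell(\lambda)=\ell$ and $\lambda_i=0$ for $i>\ell$. It is identified with its shifted Young diagram, the set of boxes $(i,j)$ with $1\le i\le\ell$, $i+1\le j\le i+\lambda_i$. The content of $(i,j)$ is $j-i$. The hook length of a box $(i,j)$ is the number of boxes of $\lambda$ to its right in row $i$, plus the number of boxes below it in column $j$, plus $1$, plus $\lambda_j$; $H_\lambda$ is the product of all hook lengths. The outer corners of $\lambda$ are the boxes whose removal leaves a strict partition; list them as $(\alpha_1,\beta_1),\dots,(\alpha_m,\beta_m)$ with $\alpha_1>\dots>\alpha_m$ and put $\alpha_{m+1}=0$, $\beta_0=\ell(\lambda)+1$. Let $y_j=\beta_j-\alpha_j$ for $1\le j\le m$, and $x_i=\beta_i-\alpha_{i+1}$ for $0\le i\le m$ (the contents of the inner corners $(\alpha_{i+1},\beta_i)$). For $k\ge 0$ let $$q_k(\lambda)=\sum_{i=0}^m\binom{x_i}{2}^k-\sum_{i=1}^m\binom{y_i}{2}^k\qquad(0^0=1),$$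 and for a partition $\nu=(\nu_1,\dots,\nu_r)$ let $q_\nu(\lambda)=\prod_{j=1}^r q_{\nu_j}(\lambda)$. Write $\lambda^+$ for any strict partition containing $\lambda$ with $|\lambda^+|=|\lambda|+1$, and for a function $g$ of strict partitions let $$D g(\lambda)=\sum_{\ell(\lambda^+)>\ell(\lambda)}g(\lambda^+)+2\sum_{\ell(\lambda^+)=\ell(\lambda)}g(\lambda^+)-g(\lambda).$$ Theorem. (1) For every partition $\nu$ there are rational numbers $\xi_\delta$, indexed by the partitions $\delta$ with $|\delta|\le|\nu|-1$, such that for every strict partition $\lambda$ $$D\Bigl(\frac{q_\nu(\lambda)}{H_\lambda}\Bigr)=\sum_{|\delta|\le|\nu|-1}\xi_\delta\,\frac{q_\delta(\lambda)}{H_\lambda}.$$ (2) For every integer $k\ge0$ there are rational numbers $\xi_0,\dots,\xi_{k-1}$ such that, for every strict partition $\lambda$ and every strict partition $\lambda^+$ obtained from $\lambda$ by adding one box, of content $x$, $$q_k(\lambda^+)-q_k(\lambda)=\sum_{j=0}^{k-1}\xi_j\binom{x}{2}^j.$$ -/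

import Mathlib

/-- A strict partition: a finite strictly decreasing sequence of positive integers. -/
@[ext]
structure StrictPartition where
  parts : List ℕ
  strictAnti : parts.Pairwise (· > ·)
  pos : ∀ p ∈ parts, 0 < p

namespace StrictPartition

/-- The part `lam_i` for `i ≥ 1`; it is `0` for `i > ℓ(lam)`. Rows are numbered from `1`. -/
def part (lam : StrictPartition) (i : ℕ) : ℕ := lam.parts.getD (i - 1) 0

/-- The size `|lam|`. -/
def size (lam : StrictPartition) : ℕ := lam.parts.sum

/-- The length `ℓ(lam)`. -/
def length (lam : StrictPartition) : ℕ := lam.parts.length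

/-- Containment `lam ⊆ mu`: every part of `lam` is at most the corresponding part of `mu`. -/
def Contained (lam mu : StrictPartition) : Prop := ∀ i, 1 ≤ i → lam.part i ≤ mu.part i

/-- The boxes `(i, j)` of the shifted Young diagram: row `i` consists of the boxes
`(i, i + 1), …, (i, i + lam_i)`. -/
def diagram (lam : StrictPartition) : Finset (ℕ × ℕ) :=
  (Finset.Icc 1 lam.length).biUnion fun i =>
    (Finset.Icc (i + 1) (i + lam.part i)).image fun j => (i, j)

theorem part_eq_zero (lam : StrictPartition) {i : ℕ} (hi : lam.length < i) : lam.part i = 0 := by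
  unfold part length at *
  rw [List.getD_eq_default]
  omega

theorem mem_diagram (lam : StrictPartition) (i j : ℕ) :
    (i, j) ∈ lam.diagram ↔ 1 ≤ i ∧ i < j ∧ j ≤ i + lam.part i := by
  simp only [diagram, Finset.mem_biUnion, Finset.mem_Icc, Finset.mem_image, Prod.mk.injEq]
  constructor
  · rintro ⟨a, ⟨h1, -⟩, b, ⟨h3, h4⟩, rfl, rfl⟩
    exact ⟨h1, h3, h4⟩
  · rintro ⟨h1, h2, h3⟩
    refine ⟨i, ⟨h1, ?_⟩, j, ⟨h2, h3⟩, rfl, rfl⟩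
    by_contra h
    have := lam.part_eq_zero (not_le.mp h)
    omega

/-- The content `j - i` of a box or corner `(i, j)`. It is only used where `i < j`, so the
subtraction of natural numbers is a genuine one. -/
def content (b : ℕ × ℕ) : ℕ := b.2 - b.1

/-- The hook length of the box `(i, j)`: the number of boxes to its right, plus the number of boxes
below it, plus one for the box itself, plus the part `lam_j`. -/
def hook (lam : StrictPartition) (b : ℕ × ℕ) : ℕ :=
  (lam.diagram.filter fun c => c.1 = b.1 ∧ b.2 < c.2).card +
    (lam.diagram.filter fun c => c.2 = b.2 ∧ b.1 < c.1).card + 1 + lam.part b.2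

/-- The product `H_lam` of all hook lengths. -/
def hookProd (lam : StrictPartition) : ℕ := ∏ b ∈ lam.diagram, lam.hook b

open Classical in
/-- The outer corners: the boxes that can be removed to leave a strict partition. -/
noncomputable def outerCorners (lam : StrictPartition) : Finset (ℕ × ℕ) :=
  lam.diagram.filter fun b => ∃ mu : StrictPartition, mu.diagram = lam.diagram.erase b

/-- The outer corners `(α₁, β₁), …, (α_m, β_m)` listed so that `α₁ > α₂ > ⋯ > α_m`. -/
noncomputable def outerList (lam : StrictPartition) : List (ℕ × ℕ) :=
  ((lam.outerCorners.map toLex.toEmbedding).sort (· ≥ ·)).map ofLex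

/-- The inner corners `(α₁, β₀), (α₂, β₁), …, (α_{m+1}, β_m)`, where `α_{m+1} = 0` and
`β₀ = ℓ(lam) + 1`. -/
noncomputable def innerList (lam : StrictPartition) : List (ℕ × ℕ) :=
  (lam.outerList.map Prod.fst ++ [0]).zip ((lam.length + 1) :: lam.outerList.map Prod.snd)

/-- `q_k(lam) = ∑_{i=0}^m C(x_i, 2)^k - ∑_{i=1}^m C(y_i, 2)^k`, where the `x_i` are the contents of
the inner corners and the `y_i` those of the outer corners. -/
noncomputable def q (k : ℕ) (lam : StrictPartition) : ℚ :=
  (lam.innerList.map fun c => ((content c).choose 2 : ℚ) ^ k).sum -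
    (lam.outerList.map fun c => ((content c).choose 2 : ℚ) ^ k).sum

/-- `q_nu(lam)`, the product of the `q_k(lam)` over the parts `k` of the partition `nu`. -/
noncomputable def qPartition {n : ℕ} (nu : n.Partition) (lam : StrictPartition) : ℚ :=
  (nu.parts.map fun k => q k lam).prod

/-- The strict partition `mu` is obtained from `lam` by adding one box. -/
def IsPlus (lam mu : StrictPartition) : Prop := lam.Contained mu ∧ mu.size = lam.size + 1

theorem finite_isPlus (lam : StrictPartition) : {mu | lam.IsPlus mu}.Finite := by
  let f : {mu // lam.IsPlus mu} → (lam.size + 1).Partition := fun mu =>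
    { parts := (mu.1.parts : Multiset ℕ)
      parts_pos := fun {i} hi => mu.1.pos i (by simpa using hi)
      parts_sum := by simpa [size] using mu.2.2 }
  have hf : Function.Injective f := by
    intro a b hab
    have h : (a.1.parts : Multiset ℕ) = (b.1.parts : Multiset ℕ) := congrArg Nat.Partition.parts hab
    have hp : a.1.parts = b.1.parts :=
      (Multiset.coe_eq_coe.mp h).eq_of_pairwise
        (fun x y _ _ h1 h2 => absurd h1 (not_lt.mpr (le_of_lt h2))) a.1.strictAnti b.1.strictAnti
    exact Subtype.ext (StrictPartition.ext hp)
  have : Finite {mu // lam.IsPlus mu} := Finite.of_injective f hf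
  exact Set.finite_coe_iff.mp this

/-- The finite set of all strict partitions obtained from `lam` by adding one box. -/
noncomputable def plus (lam : StrictPartition) : Finset StrictPartition :=
  lam.finite_isPlus.toFinset

/-- The difference operator
`D g(lam) = ∑_{ℓ(lam⁺) > ℓ(lam)} g(lam⁺) + 2 ∑_{ℓ(lam⁺) = ℓ(lam)} g(lam⁺) - g(lam)`. -/
noncomputable def D (g : StrictPartition → ℚ) (lam : StrictPartition) : ℚ :=
  (∑ mu ∈ lam.plus with lam.length < mu.length, g mu) +
    2 * (∑ mu ∈ lam.plus with mu.length = lam.length, g mu) - g lam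

end StrictPartition

/-! Everything is read off the set P of parts. Write t(a) = C(a, 2). A sum over inner corners minus
a sum over outer corners telescopes along the rows, which gives q_k = 0^k + ∑_{a ∈ P} (t(a+1)^k -
t(a)^k) (`q_eq`). A box added to a row of length a has content a + 1 and replaces a by a + 1, so q_k
changes by t(a+2)^k - 2u^k + t(a)^k with u = t(a+1). As t(a+2) + t(a) = 2u + 1 and t(a+2) t(a) = u²
- u, this is a polynomial in u. Its degree is below k (`degree_qStep`), which is claim (2).

For claim (1), H is ∏ a! ∏_{a > b} (a+b)/(a-b) (`hookProd_eq`). Hence H_λ / H_{λ⁺}, times the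
coefficient 1 or 2 from D, is the residue w_a at z = t(a+1) of ∏_{b ∈ P} (z - t(b)) / ∏_{c ∈ P ∪
{0}} (z - t(c+1)) (`schurProd_div`). This residue vanishes when no box can be added, so H_λ D(q_ν/H)
is a sum over all a ∈ P ∪ {0} of w_a times a product of shifted q's, minus q_ν. The moments ∑ w_a
t(a+1)^k obey Newton's recursion with the q_j as power sums (`newton_moment`), so they are
polynomials in the q_j of weight k. After expansion the unshifted term cancels q_ν, because the
residues sum to 1, and every shift of q_k has degree below k, so the weight drops. -/

namespace StrictPartition

/-! ### Strict partitions and their sets of parts -/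

/-- The set of parts of a strict partition. -/
def partSet (lam : StrictPartition) : Finset ℕ := lam.parts.toFinset

theorem nodup_parts (lam : StrictPartition) : lam.parts.Nodup :=
  lam.strictAnti.imp fun h => (ne_of_gt h)

theorem partSet_injective : Function.Injective partSet := by
  intro a b h
  have hp : a.parts.Perm b.parts :=
    List.perm_of_nodup_nodup_toFinset_eq a.nodup_parts b.nodup_parts h
  exact StrictPartition.ext (hp.eq_of_pairwise
    (fun x y _ _ h1 h2 => absurd h1 (not_lt.mpr (le_of_lt h2))) a.strictAnti b.strictAnti)

theorem card_partSet (lam : StrictPartition) : lam.partSet.card = lam.length :=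
  List.toFinset_card_of_nodup lam.nodup_parts

theorem part_eq_getElem (lam : StrictPartition) {i : ℕ} (h1 : 1 ≤ i) (h2 : i ≤ lam.length) :
    lam.part i = lam.parts[i - 1]'(by unfold length at h2; omega) := by
  unfold part
  rw [List.getD_eq_getElem]

theorem part_pos (lam : StrictPartition) {i : ℕ} (h1 : 1 ≤ i) (h2 : i ≤ lam.length) :
    0 < lam.part i := by
  rw [lam.part_eq_getElem h1 h2]
  exact lam.pos _ (List.getElem_mem _)

theorem le_length_of_part_pos (lam : StrictPartition) {i : ℕ} (h : 0 < lam.part i) :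
    i ≤ lam.length := by
  by_contra h'
  have := lam.part_eq_zero (not_le.mp h')
  omega

theorem part_lt_part (lam : StrictPartition) {i j : ℕ} (h1 : 1 ≤ i) (hij : i < j)
    (hi : i ≤ lam.length) : lam.part j < lam.part i := by
  rcases le_or_gt j lam.length with hj | hj
  · rw [lam.part_eq_getElem h1 hi, lam.part_eq_getElem (by omega) hj]
    exact List.pairwise_iff_getElem.mp lam.strictAnti _ _ _ _ (by omega)
  · rw [lam.part_eq_zero hj]
    exact lam.part_pos h1 hi

theorem eq_of_part_eq (lam : StrictPartition) {i j : ℕ} (h1 : 1 ≤ i) (h2 : 1 ≤ j)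
    (h : lam.part i = lam.part j) (hpos : 0 < lam.part i) : i = j := by
  have hi := lam.le_length_of_part_pos hpos
  have hj := lam.le_length_of_part_pos (h ▸ hpos)
  rcases lt_trichotomy i j with hij | hij | hij
  · have := lam.part_lt_part h1 hij hi; omega
  · exact hij
  · have := lam.part_lt_part h2 hij hj; omega

theorem partSet_eq_image (lam : StrictPartition) :
    lam.partSet = (Finset.Icc 1 lam.length).image lam.part := by
  ext x
  simp only [partSet, List.mem_toFinset, Finset.mem_image, Finset.mem_Icc]
  constructor
  · intro h
    obtain ⟨i, hi, rfl⟩ := List.mem_iff_getElem.mp h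
    refine ⟨i + 1, ⟨by omega, hi⟩, ?_⟩
    rw [lam.part_eq_getElem (by omega) hi]
    simp
  · rintro ⟨i, ⟨h1, h2⟩, rfl⟩
    rw [lam.part_eq_getElem h1 h2]
    exact List.getElem_mem _

theorem injOn_part (lam : StrictPartition) :
    Set.InjOn lam.part (Finset.Icc 1 lam.length : Finset ℕ) := by
  intro i hi j hj h
  rw [Finset.mem_coe, Finset.mem_Icc] at hi hj
  exact lam.eq_of_part_eq hi.1 hj.1 h (lam.part_pos hi.1 hi.2)

theorem mem_partSet (lam : StrictPartition) (x : ℕ) :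
    x ∈ lam.partSet ↔ 0 < x ∧ ∃ i, 1 ≤ i ∧ lam.part i = x := by
  rw [partSet_eq_image, Finset.mem_image]
  constructor
  · rintro ⟨i, hi, rfl⟩
    rw [Finset.mem_Icc] at hi
    exact ⟨lam.part_pos hi.1 hi.2, i, hi.1, rfl⟩
  · rintro ⟨h, i, hi, rfl⟩
    exact ⟨i, Finset.mem_Icc.mpr ⟨hi, lam.le_length_of_part_pos h⟩, rfl⟩

theorem zero_notMem_partSet (lam : StrictPartition) : 0 ∉ lam.partSet := by
  simp [mem_partSet]

theorem size_eq_sum (lam : StrictPartition) {N : ℕ} (hN : lam.length ≤ N) :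
    lam.size = ∑ i ∈ Finset.Icc 1 N, lam.part i := by
  have h1 : lam.size = ∑ i ∈ Finset.Icc 1 lam.length, lam.part i := by
    have h := List.sum_toFinset (fun x : ℕ => x) lam.nodup_parts
    rw [List.map_id'] at h
    rw [size, ← h]
    change ∑ x ∈ lam.partSet, x = _
    rw [partSet_eq_image, Finset.sum_image lam.injOn_part]
  rw [h1]
  refine Finset.sum_subset (Finset.Icc_subset_Icc le_rfl hN) fun i hi hi' => ?_
  rw [Finset.mem_Icc] at hi hi'
  exact lam.part_eq_zero (by omega)

/-- A strictly decreasing sequence which ends in zeros is the sequence of parts of a strict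
partition. -/
theorem exists_part_eq (f : ℕ → ℕ) (N : ℕ) (hN : f (N + 1) = 0)
    (hf : ∀ i, 1 ≤ i → 0 < f i → f (i + 1) < f i) (hz : ∀ i, 1 ≤ i → f i = 0 → f (i + 1) = 0) :
    ∃ lam : StrictPartition, ∀ i, 1 ≤ i → lam.part i = f i := by
  classical
  have hex : ∃ n, f (n + 1) = 0 := ⟨N, hN⟩
  have hpos : ∀ i, i < Nat.find hex → 0 < f (i + 1) := fun i hi =>
    Nat.pos_of_ne_zero (Nat.find_min hex hi)
  have hzero : ∀ i, Nat.find hex ≤ i → f (i + 1) = 0 := by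
    intro i hi
    induction i, hi using Nat.le_induction with
    | base => exact Nat.find_spec hex
    | succ n _ ih => exact hz _ (by omega) ih
  have hanti : ∀ i j, i < j → i < Nat.find hex → f (j + 1) < f (i + 1) := by
    intro i j hij
    induction j, hij using Nat.le_induction with
    | base => exact fun h => hf _ (by omega) (hpos _ h)
    | succ n hn ih =>
      intro h
      have h1 := ih h
      rcases Nat.eq_zero_or_pos (f (n + 1)) with h0 | h0
      · rw [hz _ (by omega) h0]; omega
      · exact (hf _ (by omega) h0).trans h1
  refine ⟨⟨(List.range (Nat.find hex)).map fun i => f (i + 1), ?_, ?_⟩, ?_⟩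
  · rw [List.pairwise_map]
    exact List.pairwise_lt_range.imp_of_mem fun {a b} ha _ hab =>
      hanti a b hab (List.mem_range.mp ha)
  · intro p hp
    obtain ⟨i, hi, rfl⟩ := List.mem_map.mp hp
    exact hpos i (List.mem_range.mp hi)
  · intro i hi
    unfold part
    rcases lt_or_ge (i - 1) (Nat.find hex) with h | h
    · rw [List.getD_eq_getElem _ _ (by simpa using h)]
      simp [Nat.sub_add_cancel hi]
    · rw [List.getD_eq_default _ _ (by simpa using h)]
      have := hzero _ h
      rw [Nat.sub_add_cancel hi] at this
      exact this.symm

/-! ### Adding and removing a box -/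

/-- The strict partition `mu` is obtained from `lam` by adding one box in row `r`. -/
def AddAt (lam mu : StrictPartition) (r : ℕ) : Prop :=
  1 ≤ r ∧ mu.part r = lam.part r + 1 ∧ ∀ i, 1 ≤ i → i ≠ r → mu.part i = lam.part i

namespace AddAt

variable {lam mu : StrictPartition} {r : ℕ}

theorem unique (h : AddAt lam mu r) {s : ℕ} (h' : AddAt lam mu s) : s = r := by
  by_contra hs
  have := h.2.2 s h'.1 hs
  have := h'.2.1
  omega

theorem succ_notMem (h : AddAt lam mu r) : lam.part r + 1 ∉ lam.partSet := by
  intro hm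
  obtain ⟨-, s, hs, e⟩ := (lam.mem_partSet _).mp hm
  have hsr : s ≠ r := by rintro rfl; omega
  have h1 := h.2.2 s hs hsr
  have h2 := h.2.1
  exact hsr (mu.eq_of_part_eq hs h.1 (by omega) (by omega))

theorem partSet_eq (h : AddAt lam mu r) :
    mu.partSet = insert (lam.part r + 1) (lam.partSet.erase (lam.part r)) := by
  ext x
  rw [Finset.mem_insert, Finset.mem_erase, mem_partSet, mem_partSet]
  constructor
  · rintro ⟨hx, i, hi, rfl⟩
    by_cases hir : i = r
    · subst hir; exact Or.inl h.2.1
    · have e := h.2.2 i hi hir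
      refine Or.inr ⟨fun e' => hir ?_, hx, i, hi, e.symm⟩
      exact lam.eq_of_part_eq hi h.1 (by omega) (by omega)
  · rintro (rfl | ⟨hne, hx, i, hi, rfl⟩)
    · exact ⟨by omega, r, h.1, h.2.1⟩
    · have hir : i ≠ r := by rintro rfl; exact hne rfl
      exact ⟨hx, i, hi, h.2.2 i hi hir⟩

theorem mem_insert_zero (h : AddAt lam mu r) : lam.part r ∈ insert 0 lam.partSet := by
  rw [Finset.mem_insert, mem_partSet]
  by_cases h0 : lam.part r = 0
  · exact Or.inl h0
  · exact Or.inr ⟨by omega, r, h.1, rfl⟩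

theorem length_eq (h : AddAt lam mu r) :
    mu.length = if lam.part r = 0 then lam.length + 1 else lam.length := by
  rw [← card_partSet, ← card_partSet, h.partSet_eq, Finset.card_insert_of_notMem
    fun hm => h.succ_notMem (Finset.mem_of_mem_erase hm)]
  split_ifs with h0
  · rw [h0, Finset.erase_eq_of_notMem lam.zero_notMem_partSet]
  · exact Finset.card_erase_add_one ((Finset.mem_insert.mp h.mem_insert_zero).resolve_left h0)

theorem contained (h : AddAt lam mu r) : lam.Contained mu := by
  intro i hi
  by_cases hir : i = r
  · subst hir; have := h.2.1; omega
  · exact (h.2.2 i hi hir).ge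

theorem isPlus (h : AddAt lam mu r) : lam.IsPlus mu := by
  refine ⟨h.contained, ?_⟩
  have hr : r ∈ Finset.Icc 1 (max r (max lam.length mu.length)) :=
    Finset.mem_Icc.mpr ⟨h.1, le_max_left _ _⟩
  rw [lam.size_eq_sum (N := max r (max lam.length mu.length)) (by simp),
    mu.size_eq_sum (N := max r (max lam.length mu.length)) (by simp),
    ← Finset.add_sum_erase _ _ hr, ← Finset.add_sum_erase _ lam.part hr, h.2.1,
    Finset.sum_congr rfl fun i hi => h.2.2 i
      (Finset.mem_Icc.mp (Finset.mem_of_mem_erase hi)).1 (Finset.ne_of_mem_erase hi)]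
  exact add_right_comm _ _ _

theorem diagram_eq (h : AddAt lam mu r) :
    mu.diagram.erase (r, r + mu.part r) = lam.diagram := by
  ext ⟨i, j⟩
  rw [Finset.mem_erase, mem_diagram, mem_diagram, Ne, Prod.mk.injEq]
  by_cases hir : i = r
  · subst hir
    have := h.2.1
    omega
  · constructor
    · rintro ⟨-, h1, h2, h3⟩
      have := h.2.2 i h1 hir
      omega
    · rintro ⟨h1, h2, h3⟩
      have := h.2.2 i h1 hir
      omega

end AddAt

theorem IsPlus.exists_addAt {lam mu : StrictPartition} (h : lam.IsPlus mu) :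
    ∃ r, AddAt lam mu r := by
  obtain ⟨hc, hs⟩ := h
  set N := max lam.length mu.length with hN
  rw [lam.size_eq_sum (N := N) (by simp [hN]), mu.size_eq_sum (N := N) (by simp [hN])] at hs
  have hle : ∀ i ∈ Finset.Icc 1 N, lam.part i ≤ mu.part i := fun i hi =>
    hc i (Finset.mem_Icc.mp hi).1
  obtain ⟨r, hr, hlt⟩ : ∃ r ∈ Finset.Icc 1 N, lam.part r < mu.part r := by
    by_contra! hcon
    have := Finset.sum_le_sum hcon
    omega
  rw [← Finset.add_sum_erase _ _ hr, ← Finset.add_sum_erase _ lam.part hr] at hs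
  have hle' : ∀ i ∈ (Finset.Icc 1 N).erase r, lam.part i ≤ mu.part i := fun i hi =>
    hle i (Finset.mem_of_mem_erase hi)
  have h2 := Finset.sum_le_sum hle'
  have h3 := (Finset.sum_eq_sum_iff_of_le hle').mp (by omega)
  refine ⟨r, (Finset.mem_Icc.mp hr).1, by omega, fun i hi hir => ?_⟩
  by_cases hiN : i ≤ N
  · exact (h3 i (Finset.mem_erase.mpr ⟨hir, Finset.mem_Icc.mpr ⟨hi, hiN⟩⟩)).symm
  · rw [lam.part_eq_zero (by omega), mu.part_eq_zero (by omega)]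

theorem addAt_of_diagram_eq_insert {lam mu : StrictPartition} {b : ℕ × ℕ} (hb : b ∉ lam.diagram)
    (h : mu.diagram = insert b lam.diagram) :
    AddAt lam mu b.1 ∧ b.2 = b.1 + lam.part b.1 + 1 := by
  obtain ⟨r, c⟩ := b
  have key : ∀ i j, (1 ≤ i ∧ i < j ∧ j ≤ i + mu.part i) ↔
      ((i = r ∧ j = c) ∨ (1 ≤ i ∧ i < j ∧ j ≤ i + lam.part i)) := by
    intro i j
    rw [← mem_diagram, ← mem_diagram, h, Finset.mem_insert, Prod.mk.injEq]
  rw [mem_diagram] at hb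
  have h0 := (key r c).mpr (Or.inl ⟨rfl, rfl⟩)
  have hlt : lam.part r < mu.part r := by omega
  have h1 := (key r (r + lam.part r + 1)).mp (by omega)
  have h2 := (key r (r + mu.part r)).mp (by omega)
  simp only at *
  refine ⟨⟨h0.1, by omega, fun i hi hir => ?_⟩, by omega⟩
  have h3 := key i (i + lam.part i)
  have h4 := key i (i + mu.part i)
  simp only [hir, false_and, false_or] at h3 h4
  omega

/-- A box can be added to a row of length `a` if `a + 1` is not a part. -/
theorem exists_addAt (lam : StrictPartition) {a : ℕ} (ha : a ∈ insert 0 lam.partSet)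
    (ha' : a + 1 ∉ lam.partSet) : ∃ mu r, AddAt lam mu r ∧ lam.part r = a := by
  obtain ⟨r, hr, hra, hrl⟩ : ∃ r, 1 ≤ r ∧ lam.part r = a ∧ r ≤ lam.length + 1 := by
    rcases Finset.mem_insert.mp ha with rfl | h
    · exact ⟨lam.length + 1, by omega, lam.part_eq_zero (by omega), le_rfl⟩
    · obtain ⟨h0, i, hi, rfl⟩ := (lam.mem_partSet _).mp h
      exact ⟨i, hi, rfl, (lam.le_length_of_part_pos h0).trans (by omega)⟩
  -- The row above is longer than a and does not have length a + 1, so it stays strictly longer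
  -- after the addition.
  have hprev : ∀ i, 1 ≤ i → i + 1 = r → a + 1 < lam.part i := by
    intro i hi hir
    have h1 := lam.part_lt_part hi (show i < r by omega) (by omega)
    have h2 : lam.part i ≠ a + 1 := fun e => ha' ((lam.mem_partSet _).mpr ⟨by omega, i, hi, e⟩)
    omega
  obtain ⟨mu, hmu⟩ := exists_part_eq (fun i => if i = r then a + 1 else lam.part i)
    (lam.length + 1) (by rw [if_neg (by omega)]; exact lam.part_eq_zero (by omega))
    (by
      intro i hi hpos
      split_ifs at hpos ⊢ with h1 h2 h2
      · omega
      · exact hprev i hi h1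
      · subst h2
        by_cases h0 : 0 < lam.part i
        · have := lam.part_lt_part hi (Nat.lt_add_one i) (lam.le_length_of_part_pos h0)
          omega
        · have : lam.length < i := by
            by_contra hc
            exact h0 (lam.part_pos hi (not_lt.mp hc))
          rw [lam.part_eq_zero (by omega)]
          omega
      · exact lam.part_lt_part hi (Nat.lt_add_one i) (lam.le_length_of_part_pos hpos))
    (by
      intro i hi hz
      split_ifs at hz ⊢ with h1 h2
      · have := hprev i hi h1; omega
      · refine lam.part_eq_zero ?_
        by_contra hc
        have := lam.part_pos hi (by omega)
        omega)
  refine ⟨mu, r, ⟨hr, ?_, fun i hi hir => ?_⟩, hra⟩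
  · rw [hmu r hr, if_pos rfl, hra]
  · rw [hmu i hi, if_neg hir]

/-- The last box of row `r` can be removed if `lam.part r - 1` is not a part. -/
theorem exists_addAt_right (lam : StrictPartition) {r : ℕ} (hr : 1 ≤ r) (hrl : r ≤ lam.length)
    (h : lam.part (r + 1) + 1 < lam.part r ∨ lam.part r = 1) : ∃ mu, AddAt mu lam r := by
  have hpos := lam.part_pos hr hrl
  obtain ⟨mu, hmu⟩ := exists_part_eq (fun i => if i = r then lam.part r - 1 else lam.part i)
    (lam.length + 1) (by rw [if_neg (by omega)]; exact lam.part_eq_zero (by omega))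
    (by
      intro i hi hp
      split_ifs at hp ⊢ with h1 h2 h2
      · omega
      · have := lam.part_lt_part hi (show i < r by omega) (by omega)
        omega
      · subst h2; omega
      · exact lam.part_lt_part hi (Nat.lt_add_one i) (lam.le_length_of_part_pos hp))
    (by
      intro i hi hz
      split_ifs at hz ⊢ with h1 h2 h2
      · omega
      · have := lam.part_pos hi (show i ≤ lam.length by omega)
        omega
      · subst h2
        have := lam.part_lt_part hi (Nat.lt_add_one i) hrl
        omega
      · refine lam.part_eq_zero ?_
        by_contra hc
        have := lam.part_pos hi (by omega)
        omega)
  refine ⟨mu, hr, ?_, fun i hi hir => ?_⟩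
  · rw [hmu r hr, if_pos rfl]; omega
  · rw [hmu i hi, if_neg hir]

/-! ### Corners, and the telescoped form of q_k -/

/-- The rows whose last box is an outer corner. -/
def IsOuterRow (lam : StrictPartition) (r : ℕ) : Prop :=
  1 ≤ r ∧ r ≤ lam.length ∧ (lam.part (r + 1) + 1 < lam.part r ∨ lam.part r = 1)

theorem mem_outerCorners (lam : StrictPartition) (b : ℕ × ℕ) :
    b ∈ lam.outerCorners ↔ lam.IsOuterRow b.1 ∧ b.2 = b.1 + lam.part b.1 := by
  classical
  unfold outerCorners
  rw [Finset.mem_filter]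
  constructor
  · rintro ⟨hb, mu, hmu⟩
    obtain ⟨h, h2⟩ := addAt_of_diagram_eq_insert (lam := mu) (mu := lam) (b := b)
      (by rw [hmu]; exact Finset.notMem_erase _ _) (by rw [hmu, Finset.insert_erase hb])
    have e1 := h.2.1
    have e2 := h.2.2 (b.1 + 1) (by omega) (by omega)
    refine ⟨⟨h.1, lam.le_length_of_part_pos (by omega), ?_⟩, by omega⟩
    by_cases h0 : 0 < mu.part b.1
    · have := mu.part_lt_part h.1 (Nat.lt_add_one _) (mu.le_length_of_part_pos h0)
      omega
    · omega
  · rintro ⟨⟨h1, h2, h3⟩, h4⟩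
    obtain ⟨mu, hmu⟩ := lam.exists_addAt_right h1 h2 h3
    have hpos := lam.part_pos h1 h2
    obtain ⟨i, j⟩ := b
    simp only at *
    refine ⟨(lam.mem_diagram _ _).mpr (by omega), mu, ?_⟩
    rw [h4]
    exact hmu.diagram_eq.symm

/-- A row that is not an outer row exceeds the next one by exactly one. -/
theorem part_add_of_not_isOuterRow (lam : StrictPartition) {α s d : ℕ} (hα : α ≤ lam.length)
    (hs : s + 1 + d = α) (h : ∀ r, s < r → r < α → ¬ lam.IsOuterRow r) :
    lam.part (s + 1) = lam.part α + d := by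
  induction d generalizing s with
  | zero => subst hs; rfl
  | succ d ih =>
    have h1 := ih (s := s + 1) (by omega) fun r hr => h r (by omega)
    have h2 := h (s + 1) (by omega) (by omega)
    have h3 := lam.part_lt_part (i := s + 1) (by omega) (Nat.lt_add_one _) (by omega)
    unfold IsOuterRow at h2
    omega

/-- The parts in such a block of rows are consecutive integers, so the sum telescopes. If row α ends
in an outer corner and s is the row of the next one (or 0), the two surviving arguments are the
contents of the inner corner (s, α + λ_α) and of that outer corner. -/
theorem sum_Ioc_sub_of_not_isOuterRow (lam : StrictPartition) (g : ℕ → ℚ) {α s d : ℕ}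
    (hα : α ≤ lam.length) (hs : s + 1 + d = α)
    (h : ∀ r, s < r → r < α → ¬ lam.IsOuterRow r) :
    ∑ r ∈ Finset.Ioc s α, (g (lam.part r + 1) - g (lam.part r)) =
      g (α + lam.part α - s) - g (lam.part α) := by
  induction d generalizing s with
  | zero =>
    subst hs
    rw [add_zero, Finset.sum_eq_single_of_mem (s + 1) (by simp)
      (fun r hr hne => absurd (Finset.mem_Ioc.mp hr) (by omega))]
    congr 2
    omega
  | succ d ih =>
    have h1 := ih (s := s + 1) (by omega) fun r hr => h r (by omega)
    have h2 := lam.part_add_of_not_isOuterRow hα hs h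
    rw [← Finset.insert_Ioc_add_one_left_eq_Ioc (show s < α by omega),
      Finset.sum_insert (by simp), h1, h2,
      show α + lam.part α - (s + 1) = lam.part α + (d + 1) by omega,
      show α + lam.part α - s = lam.part α + (d + 1) + 1 by omega]
    ring

theorem mem_outerList (lam : StrictPartition) (b : ℕ × ℕ) :
    b ∈ lam.outerList ↔ lam.IsOuterRow b.1 ∧ b.2 = b.1 + lam.part b.1 := by
  rw [← mem_outerCorners]
  simp [outerList]

/-- The list is sorted lexicographically, and a row contains at most one outer corner, so ties in
the first coordinate do not occur. -/
theorem pairwise_outerList (lam : StrictPartition) :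
    lam.outerList.Pairwise fun b c => c.1 < b.1 := by
  have hmem := lam.mem_outerList
  unfold outerList at hmem ⊢
  set s := (lam.outerCorners.map toLex.toEmbedding).sort (· ≥ ·) with hs
  have h1 : s.Pairwise (· ≥ ·) := Finset.pairwise_sort _ _
  have h2 : s.Nodup := Finset.sort_nodup _ _
  rw [List.pairwise_map]
  refine (h1.and h2).imp_of_mem fun {b c} hb hc hbc => ?_
  have hb' := ((hmem (ofLex b)).mp (List.mem_map_of_mem hb)).2
  have hc' := ((hmem (ofLex c)).mp (List.mem_map_of_mem hc)).2
  rcases Prod.Lex.le_iff.mp hbc.1 with h | ⟨h, -⟩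
  · exact h
  · refine absurd ?_ hbc.2
    apply ofLex.injective
    refine Prod.ext h.symm ?_
    rw [hb', hc', h]

/-- The inner corner (α_{i+1}, β_i) paired with the outer corner (α_i, β_i) accounts for the rows in
(α_{i+1}, α_i], and these blocks tile the rows up to the first corner. -/
theorem sum_zip_sub (lam : StrictPartition) (g : ℕ → ℚ) (b : ℕ × ℕ) (l : List (ℕ × ℕ))
    (hl : (b :: l).Pairwise fun b c => c.1 < b.1)
    (hmem : ∀ c ∈ b :: l, lam.IsOuterRow c.1 ∧ c.2 = c.1 + lam.part c.1)
    (hall : ∀ r, lam.IsOuterRow r → r ≤ b.1 → ∃ c ∈ b :: l, c.1 = r) :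
    (((l.map Prod.fst ++ [0]).zip ((b :: l).map Prod.snd)).map fun c => g (content c)).sum -
        ((b :: l).map fun c => g (content c)).sum =
      ∑ r ∈ Finset.Ioc 0 b.1, (g (lam.part r + 1) - g (lam.part r)) := by
  induction l generalizing b with
  | nil =>
    obtain ⟨h1, h2⟩ := hmem b (by simp)
    rw [lam.sum_Ioc_sub_of_not_isOuterRow g (d := b.1 - 1) h1.2.1 (by have := h1.1; omega)]
    · simp [content, h2]
    · intro r _ hr ho
      obtain ⟨c, hc, rfl⟩ := hall r ho hr.le
      simp only [List.mem_singleton] at hc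
      subst hc
      exact lt_irrefl _ hr
  | cons b' l ih =>
    obtain ⟨h1, h2⟩ := hmem b (by simp)
    rw [List.pairwise_cons] at hl
    have hlt : b'.1 < b.1 := hl.1 b' (by simp)
    have h3 := ih b' hl.2 (fun c hc => hmem c (List.mem_cons_of_mem _ hc)) (by
      intro r ho hr
      obtain ⟨c, hc, hcr⟩ := hall r ho (by omega)
      rcases List.mem_cons.mp hc with rfl | hc
      · omega
      · exact ⟨c, hc, hcr⟩)
    rw [← Finset.Ioc_union_Ioc_eq_Ioc (Nat.zero_le b'.1) hlt.le,
      Finset.sum_union (Finset.Ioc_disjoint_Ioc_of_le le_rfl), ← h3,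
      lam.sum_Ioc_sub_of_not_isOuterRow g (d := b.1 - b'.1 - 1) h1.2.1 (by omega)]
    · simp [content, h2]
      ring
    · intro r hr1 hr2 ho
      obtain ⟨c, hc, rfl⟩ := hall r ho hr2.le
      rcases List.mem_cons.mp hc with rfl | hc
      · exact lt_irrefl _ hr2
      · rcases List.mem_cons.mp hc with rfl | hc
        · exact lt_irrefl _ hr1
        · exact lt_asymm hr1 ((List.pairwise_cons.mp hl.2).1 c hc)

theorem sum_Ioc_eq_sum_partSet (lam : StrictPartition) (f : ℕ → ℚ) :
    ∑ r ∈ Finset.Ioc 0 lam.length, f (lam.part r) = ∑ a ∈ lam.partSet, f a := by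
  rw [partSet_eq_image, Finset.sum_image lam.injOn_part]
  rfl

/-- The last row always ends in an outer corner, so the unpaired inner corner (α₁, β₀) is (ℓ, ℓ +
1), of content 1. The empty partition gives the same term through (0, 1). -/
theorem sum_innerList_sub (lam : StrictPartition) (g : ℕ → ℚ) :
    (lam.innerList.map fun c => g (content c)).sum -
        (lam.outerList.map fun c => g (content c)).sum =
      g 1 + ∑ a ∈ lam.partSet, (g (a + 1) - g a) := by
  rw [← lam.sum_Ioc_eq_sum_partSet fun a => g (a + 1) - g a]
  have hlast : 0 < lam.length → lam.IsOuterRow lam.length := by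
    intro h
    refine ⟨h, le_rfl, ?_⟩
    have h1 := lam.part_pos h le_rfl
    have h2 := lam.part_eq_zero (Nat.lt_add_one lam.length)
    omega
  have hmem := lam.mem_outerList
  have hpw := lam.pairwise_outerList
  unfold innerList
  rcases hl : lam.outerList with _ | ⟨b, l⟩
  · have h0 : lam.length = 0 := by
      by_contra hne
      have := (hmem (lam.length, lam.length + lam.part lam.length)).mpr
        ⟨hlast (Nat.pos_of_ne_zero hne), rfl⟩
      rw [hl] at this
      simp at this
    simp [h0, content]
  · rw [hl] at hmem hpw
    have hb : b.1 = lam.length := by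
      have hbl := ((hmem b).mp (by simp)).1
      have := (hmem (lam.length, lam.length + lam.part lam.length)).mpr
        ⟨hlast (hbl.1.trans hbl.2.1), rfl⟩
      rcases List.mem_cons.mp this with h | h
      · rw [← h]
      · have h1 := (List.pairwise_cons.mp hpw).1 _ h
        have h2 := hbl.2.1
        simp only at h1
        omega
    have := lam.sum_zip_sub g b l hpw (fun c hc => (hmem c).mp hc) (fun r ho _ =>
      ⟨(r, r + lam.part r), (hmem _).mpr ⟨ho, rfl⟩, rfl⟩)
    rw [← hb, ← this]
    simp [content]
    ring

/-! ### The change of q_k when a box is added -/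

/-- The binomial coefficient `C(a, 2)` as a rational number. -/
def tri (a : ℕ) : ℚ := (a.choose 2 : ℚ)

theorem tri_eq (a : ℕ) : tri a = a * (a - 1) / 2 := Nat.cast_choose_two ℚ a

theorem q_eq (k : ℕ) (lam : StrictPartition) :
    q k lam = 0 ^ k + ∑ a ∈ lam.partSet, (tri (a + 1) ^ k - tri a ^ k) := by
  have := lam.sum_innerList_sub fun a => tri a ^ k
  simp only [show tri 1 = 0 by simp [tri]] at this
  exact this

open Polynomial in
/-- The polynomial which expresses the change of `q k` under the addition of a box. -/
noncomputable def qStep : ℕ → ℚ[X]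
  | 0 => 0
  | 1 => 1
  -- With u = t(a+1), the numbers t(a+2) and t(a) are the roots of T² - (2u+1)T + (u² - u), so their
  -- power sums satisfy the homogeneous recursion. Subtracting 2u^k from the k-th one leaves the
  -- correction 4u^(k+1).
  | k + 2 => (2 * X + 1) * qStep (k + 1) - (X ^ 2 - X) * qStep k + 4 * X ^ (k + 1)

open Polynomial in
theorem degree_qStep (k : ℕ) : (qStep k).degree < k ∧ (qStep (k + 1)).degree < (k + 1 : ℕ) := by
  induction k with
  | zero => simp [qStep]
  | succ k ih =>
    refine ⟨ih.2, ?_⟩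
    simp only [← mem_degreeLT] at *
    rw [qStep]
    have hmul : ∀ (p s : ℚ[X]) (m n N : ℕ), p.natDegree ≤ m → s ∈ degreeLT ℚ n → m + n ≤ N →
        p * s ∈ degreeLT ℚ N := by
      intro p s m n N hp hs hN
      rw [mem_degreeLT] at *
      by_cases hs0 : s = 0
      · simp [hs0]
      rw [degree_eq_natDegree hs0] at hs
      refine lt_of_le_of_lt degree_le_natDegree ?_
      have := natDegree_mul_le (p := p) (q := s)
      have hs' : s.natDegree < n := by exact_mod_cast hs
      exact_mod_cast (by omega : (p * s).natDegree < N)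
    refine Submodule.add_mem _ (Submodule.sub_mem _ (hmul _ _ 1 (k + 1) _ ?_ ih.2 (by omega))
      (hmul _ _ 2 k _ ?_ ih.1 (by omega))) ?_
    · compute_degree
    · compute_degree
    · rw [mem_degreeLT]
      refine lt_of_le_of_lt degree_le_natDegree ?_
      have : (4 * X ^ (k + 1) : ℚ[X]).natDegree ≤ k + 1 := by compute_degree
      exact_mod_cast (by omega : (4 * X ^ (k + 1) : ℚ[X]).natDegree < k + 1 + 1)

theorem eval_qStep (a k : ℕ) :
    (qStep k).eval (tri (a + 1)) = tri (a + 2) ^ k - 2 * tri (a + 1) ^ k + tri a ^ k := by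
  have key : ∀ k, (qStep k).eval (tri (a + 1)) =
      tri (a + 2) ^ k - 2 * tri (a + 1) ^ k + tri a ^ k ∧
      (qStep (k + 1)).eval (tri (a + 1)) =
      tri (a + 2) ^ (k + 1) - 2 * tri (a + 1) ^ (k + 1) + tri a ^ (k + 1) := by
    have h1 : tri (a + 2) = tri (a + 1) + (a + 1) := by simp only [tri_eq]; push_cast; ring
    have h0 : tri a = tri (a + 1) - a := by simp only [tri_eq]; push_cast; ring
    have hu : tri (a + 1) = (a + 1) * a / 2 := by simp only [tri_eq]; push_cast; ring
    intro k
    induction k with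
    | zero =>
      simp only [qStep, Polynomial.eval_zero, Polynomial.eval_one, h1, h0]
      constructor <;> ring
    | succ k ih =>
      refine ⟨ih.2, ?_⟩
      rw [qStep]
      simp only [Polynomial.eval_add, Polynomial.eval_sub, Polynomial.eval_mul, Polynomial.eval_X,
        Polynomial.eval_pow, Polynomial.eval_one, Polynomial.eval_ofNat, ih.1, ih.2]
      have hs : 2 * tri (a + 1) + 1 = tri (a + 2) + tri a := by rw [h1, h0]; ring
      have hp : tri (a + 1) ^ 2 - tri (a + 1) = tri (a + 2) * tri a := by
        rw [h1, h0, hu]; ring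
      rw [hp, hs]
      linear_combination 2 * tri (a + 1) ^ (k + 1) * hs - 2 * tri (a + 1) ^ k * hp
  exact (key k).1

theorem AddAt.q_eq {lam mu : StrictPartition} {r : ℕ} (h : AddAt lam mu r) (k : ℕ) :
    q k mu = q k lam + (qStep k).eval (tri (lam.part r + 1)) := by
  rw [StrictPartition.q_eq, StrictPartition.q_eq, h.partSet_eq, Finset.sum_insert
    (fun hm => h.succ_notMem (Finset.mem_of_mem_erase hm)), eval_qStep]
  rcases Finset.mem_insert.mp h.mem_insert_zero with h0 | h0
  -- A new row erases no part, but the summand of a = 0 would vanish anyway, since t(1) = t(0) = 0.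
  · rw [h0, Finset.erase_eq_of_notMem lam.zero_notMem_partSet]
    simp only [tri]
    norm_num
    ring
  · rw [← Finset.add_sum_erase _ _ h0]
    ring

theorem exists_q_sub_eq (k : ℕ) : ∃ xi : ℕ → ℚ, ∀ (lam mu : StrictPartition) (b : ℕ × ℕ),
    b ∉ lam.diagram → mu.diagram = insert b lam.diagram →
      q k mu - q k lam = ∑ j ∈ Finset.range k, xi j * ((content b).choose 2 : ℚ) ^ j := by
  refine ⟨(qStep k).coeff, fun lam mu b hb h => ?_⟩
  obtain ⟨h1, h2⟩ := addAt_of_diagram_eq_insert hb h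
  have hc : content b = lam.part b.1 + 1 := by unfold content; omega
  rw [h1.q_eq, add_sub_cancel_left, hc, Polynomial.eval_eq_sum_degreeLTEquiv
    (Polynomial.mem_degreeLT.mpr (degree_qStep k).1), Finset.sum_range]
  rfl

/-! ### Hook lengths and the product formula for H -/

theorem part_add_le (lam : StrictPartition) {i k : ℕ} (hi : 1 ≤ i) (hik : i ≤ k)
    (hk : k ≤ lam.length + 1) : k + lam.part k ≤ i + lam.part i := by
  induction k, hik using Nat.le_induction with
  | base => exact le_rfl
  | succ k hik ih =>
    have := lam.part_lt_part (hi.trans hik) (Nat.lt_add_one k) (by omega)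
    have := ih (by omega)
    omega

theorem card_arm (lam : StrictPartition) {i j : ℕ} (hb : (i, j) ∈ lam.diagram) :
    (lam.diagram.filter fun c => c.1 = i ∧ j < c.2).card = i + lam.part i - j := by
  rw [mem_diagram] at hb
  rw [← Nat.card_Ioc, ← Finset.card_image_of_injective (Finset.Ioc j (i + lam.part i))
    (Prod.mk_right_injective i)]
  congr 1
  ext ⟨a, b⟩
  simp only [Finset.mem_filter, mem_diagram, Finset.mem_image, Finset.mem_Ioc, Prod.mk.injEq]
  constructor
  · rintro ⟨⟨h1, h2, h3⟩, rfl, h4⟩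
    exact ⟨b, ⟨h4, h3⟩, rfl, rfl⟩
  · rintro ⟨c, ⟨h1, h2⟩, rfl, rfl⟩
    exact ⟨⟨hb.1, by omega, h2⟩, rfl, h1⟩

theorem card_leg (lam : StrictPartition) {i j : ℕ} (hi : 1 ≤ i) :
    (lam.diagram.filter fun c => c.2 = j ∧ i < c.1).card =
      ((Finset.Ioc i lam.length).filter fun k => k < j ∧ j ≤ k + lam.part k).card := by
  refine Eq.trans ?_ (Finset.card_image_of_injective _ (Prod.mk_left_injective j))
  congr 1
  ext ⟨a, b⟩
  simp only [Finset.mem_filter, mem_diagram, Finset.mem_image, Finset.mem_Ioc, Prod.mk.injEq]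
  constructor
  · rintro ⟨⟨h1, h2, h3⟩, rfl, h4⟩
    exact ⟨a, ⟨⟨h4, lam.le_length_of_part_pos (by omega)⟩, h2, h3⟩, rfl, rfl⟩
  · rintro ⟨c, ⟨⟨h1, h2⟩, h3, h4⟩, rfl, rfl⟩
    exact ⟨⟨by omega, h3, h4⟩, rfl, h1⟩

/-- Every row strictly between i and j reaches column j, so the leg is j - i - 1 and cancels against
the arm i + λ_i - j. -/
theorem hook_of_le_length (lam : StrictPartition) {i j : ℕ} (hb : (i, j) ∈ lam.diagram)
    (hj : j ≤ lam.length) : lam.hook (i, j) = lam.part i + lam.part j := by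
  have hb' := (lam.mem_diagram _ _).mp hb
  unfold hook
  simp only
  rw [lam.card_arm hb, lam.card_leg hb'.1]
  have : ((Finset.Ioc i lam.length).filter fun k => k < j ∧ j ≤ k + lam.part k) =
      Finset.Ioo i j := by
    ext k
    simp only [Finset.mem_filter, Finset.mem_Ioc, Finset.mem_Ioo]
    constructor
    · rintro ⟨⟨h1, h2⟩, h3, h4⟩
      exact ⟨h1, h3⟩
    · rintro ⟨h1, h2⟩
      have := lam.part_add_le (i := k) (k := j) (by omega) h2.le (by omega)
      exact ⟨⟨h1, by omega⟩, h2, by omega⟩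
  rw [this, Nat.card_Ioo]
  omega

/-- The number of boxes strictly below the box `(i, j)`, for `j` beyond the length. -/
def leg (lam : StrictPartition) (i j : ℕ) : ℕ :=
  ((Finset.Ioc i lam.length).filter fun k => j ≤ k + lam.part k).card

theorem hook_of_length_lt (lam : StrictPartition) {i j : ℕ} (hb : (i, j) ∈ lam.diagram)
    (hj : lam.length < j) : lam.hook (i, j) = i + lam.part i - j + lam.leg i j + 1 := by
  have hb' := (lam.mem_diagram _ _).mp hb
  unfold hook leg
  simp only
  rw [lam.card_arm hb, lam.card_leg hb'.1, lam.part_eq_zero hj, add_zero]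
  have : ((Finset.Ioc i lam.length).filter fun k => k < j ∧ j ≤ k + lam.part k) =
      (Finset.Ioc i lam.length).filter fun k => j ≤ k + lam.part k := by
    refine Finset.filter_congr fun k hk => ?_
    rw [Finset.mem_Ioc] at hk
    exact and_iff_right (by omega)
  rw [this]

theorem leg_antitone (lam : StrictPartition) (i : ℕ) {j j' : ℕ} (h : j ≤ j') :
    lam.leg i j' ≤ lam.leg i j :=
  Finset.card_le_card fun k hk => by
    rw [Finset.mem_filter] at *
    exact ⟨hk.1, h.trans hk.2⟩

/-- Row ends move weakly left going down, so the rows below i that reach column j form an initial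
segment. -/
theorem leg_spec (lam : StrictPartition) {i j k : ℕ} (hi : 1 ≤ i)
    (hk : k ∈ Finset.Ioc i lam.length) : j ≤ k + lam.part k ↔ k ≤ i + lam.leg i j := by
  rw [Finset.mem_Ioc] at hk
  constructor
  · intro h
    have : Finset.Ioc i k ⊆ (Finset.Ioc i lam.length).filter fun k => j ≤ k + lam.part k := by
      intro c hc
      rw [Finset.mem_Ioc] at hc
      rw [Finset.mem_filter, Finset.mem_Ioc]
      exact ⟨⟨hc.1, by omega⟩, h.trans (lam.part_add_le (by omega) hc.2 (by omega))⟩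
    have := Finset.card_le_card this
    rw [Nat.card_Ioc] at this
    unfold leg
    omega
  · intro h
    by_contra hc
    have : ((Finset.Ioc i lam.length).filter fun k => j ≤ k + lam.part k) ⊆ Finset.Ioo i k := by
      intro c hc'
      rw [Finset.mem_filter, Finset.mem_Ioc] at hc'
      rw [Finset.mem_Ioo]
      refine ⟨hc'.1.1, ?_⟩
      by_contra hck
      have := lam.part_add_le (i := k) (k := c) (by omega) (by omega) (by omega)
      omega
    have := Finset.card_le_card this
    rw [Nat.card_Ioo] at this
    unfold leg at h
    omega

/-- The hook lengths in columns beyond ℓ and the differences λ_i - λ_k with k > i are distinct and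
together exhaust {1, …, λ_i}. -/
theorem prod_hook_beyond_length (lam : StrictPartition) {i : ℕ} (hi : i ∈ Finset.Icc 1 lam.length) :
    (∏ j ∈ Finset.Ioc lam.length (i + lam.part i), lam.hook (i, j)) *
      ∏ k ∈ Finset.Ioc i lam.length, (lam.part i - lam.part k) = (lam.part i).factorial := by
  rw [Finset.mem_Icc] at hi
  have hL : lam.length ≤ i + lam.part i := by
    have := lam.part_add_le hi.1 hi.2 (by omega); omega
  set f : ℕ → ℕ := fun j => i + lam.part i - j + lam.leg i j + 1 with hf
  set g : ℕ → ℕ := fun k => lam.part i - lam.part k with hg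
  have hfhook : ∀ j ∈ Finset.Ioc lam.length (i + lam.part i), lam.hook (i, j) = f j := by
    intro j hj
    rw [Finset.mem_Ioc] at hj
    exact lam.hook_of_length_lt ((lam.mem_diagram _ _).mpr ⟨hi.1, by omega, hj.2⟩) hj.1
  have hfinj : Set.InjOn f (Finset.Ioc lam.length (i + lam.part i) : Finset ℕ) := by
    have hlt : ∀ a b, a < b → b ≤ i + lam.part i → f b < f a := by
      intro a b hab hb
      have := lam.leg_antitone i hab.le
      simp only [hf]
      omega
    intro a ha b hb hab
    rw [Finset.mem_coe, Finset.mem_Ioc] at ha hb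
    rcases lt_trichotomy a b with h | h | h
    · have := hlt a b h hb.2; omega
    · exact h
    · have := hlt b a h ha.2; omega
  have hgp : ∀ k ∈ Finset.Ioc i lam.length, 0 < lam.part k ∧ lam.part k < lam.part i := by
    intro k hk
    rw [Finset.mem_Ioc] at hk
    exact ⟨lam.part_pos (by omega) hk.2, lam.part_lt_part hi.1 hk.1 hi.2⟩
  have hginj : Set.InjOn g (Finset.Ioc i lam.length : Finset ℕ) := by
    intro a ha b hb hab
    have h1 := hgp a ha
    have h2 := hgp b hb
    rw [Finset.mem_coe, Finset.mem_Ioc] at ha hb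
    simp only [hg] at hab
    exact lam.eq_of_part_eq (by omega) (by omega) (by omega) h1.1
  have hdisj : Disjoint ((Finset.Ioc lam.length (i + lam.part i)).image f)
      ((Finset.Ioc i lam.length).image g) := by
    rw [Finset.disjoint_left]
    intro x hx hx'
    obtain ⟨j, hj, rfl⟩ := Finset.mem_image.mp hx
    obtain ⟨k, hk, e⟩ := Finset.mem_image.mp hx'
    have h1 := hgp k hk
    have h2 := lam.leg_spec (j := j) hi.1 hk
    rw [Finset.mem_Ioc] at hj
    simp only [hf, hg] at e
    -- If row k reaches column j, the difference λ_i - λ_k is smaller than the hook length;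
    -- otherwise it is larger.
    by_cases h3 : j ≤ k + lam.part k
    · have := h2.mp h3; omega
    · have : ¬ k ≤ i + lam.leg i j := fun h => h3 (h2.mpr h)
      omega
  have hunion : (Finset.Ioc lam.length (i + lam.part i)).image f ∪
      (Finset.Ioc i lam.length).image g = Finset.Icc 1 (lam.part i) := by
    apply Finset.eq_of_subset_of_card_le
    · intro x hx
      rw [Finset.mem_Icc]
      rcases Finset.mem_union.mp hx with h | h
      · obtain ⟨j, hj, rfl⟩ := Finset.mem_image.mp h
        have hleg : lam.leg i j ≤ lam.length - i := by
          unfold leg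
          exact (Finset.card_filter_le _ _).trans (by rw [Nat.card_Ioc])
        rw [Finset.mem_Ioc] at hj
        simp only [hf]
        omega
      · obtain ⟨k, hk, rfl⟩ := Finset.mem_image.mp h
        have := hgp k hk
        simp only [hg]
        omega
    -- The count is (i + λ_i - ℓ) + (ℓ - i) = λ_i.
    · rw [Finset.card_union_of_disjoint hdisj, Finset.card_image_of_injOn hfinj,
        Finset.card_image_of_injOn hginj, Nat.card_Ioc, Nat.card_Ioc, Nat.card_Icc]
      omega
  rw [Finset.prod_congr rfl hfhook, ← Finset.prod_image hfinj (f := fun x => x),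
    ← Finset.prod_image hginj (f := fun x => x), ← Finset.prod_union hdisj, hunion,
    ← Finset.Ico_add_one_right_eq_Icc, Finset.prod_Ico_id_eq_factorial]

theorem prod_hook_row (lam : StrictPartition) {i : ℕ} (hi : i ∈ Finset.Icc 1 lam.length) :
    (∏ j ∈ Finset.Icc (i + 1) (i + lam.part i), lam.hook (i, j)) *
      ∏ k ∈ Finset.Ioc i lam.length, (lam.part i - lam.part k) =
    (lam.part i).factorial * ∏ k ∈ Finset.Ioc i lam.length, (lam.part i + lam.part k) := by
  have h := lam.prod_hook_beyond_length hi
  rw [Finset.mem_Icc] at hi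
  have hL : lam.length ≤ i + lam.part i := by
    have := lam.part_add_le hi.1 hi.2 (by omega); omega
  rw [Finset.Icc_add_one_left_eq_Ioc, ← Finset.Ioc_union_Ioc_eq_Ioc hi.2 hL,
    Finset.prod_union (Finset.Ioc_disjoint_Ioc_of_le le_rfl), mul_assoc, h, mul_comm]
  congr 1
  refine Finset.prod_congr rfl fun j hj => ?_
  rw [Finset.mem_Ioc] at hj
  exact lam.hook_of_le_length ((lam.mem_diagram _ _).mpr ⟨hi.1, hj.1, by omega⟩) hj.2

theorem hookProd_eq_prod_rows (lam : StrictPartition) : lam.hookProd =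
    ∏ i ∈ Finset.Icc 1 lam.length, ∏ j ∈ Finset.Icc (i + 1) (i + lam.part i), lam.hook (i, j) := by
  unfold hookProd diagram
  rw [Finset.prod_biUnion]
  · refine Finset.prod_congr rfl fun i _ => ?_
    rw [Finset.prod_image fun a _ b _ h => (Prod.mk.inj h).2]
  · intro a _ b _ hab
    rw [Function.onFun, Finset.disjoint_left]
    intro x hx hx'
    obtain ⟨_, _, rfl⟩ := Finset.mem_image.mp hx
    obtain ⟨_, _, e⟩ := Finset.mem_image.mp hx'
    exact hab (Prod.mk.inj e).1.symm

/-- The product `∏ a! ∏_{a > b} (a + b) / (a - b)` over a finite set of natural numbers. -/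
def schurProd (P : Finset ℕ) : ℚ :=
  ∏ a ∈ P, ((a.factorial : ℚ) * ∏ b ∈ P.filter (· < a), ((a : ℚ) + b) / (a - b))

theorem hookProd_eq (lam : StrictPartition) : (lam.hookProd : ℚ) = schurProd lam.partSet := by
  rw [hookProd_eq_prod_rows, schurProd]
  conv_rhs => rw [partSet_eq_image]
  rw [Finset.prod_image lam.injOn_part]
  push_cast
  refine Finset.prod_congr rfl fun i hi => ?_
  have h := lam.prod_hook_row hi
  have hi' := Finset.mem_Icc.mp hi
  have hfil : (Finset.image lam.part (Finset.Icc 1 lam.length)).filter (· < lam.part i) =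
      (Finset.Ioc i lam.length).image lam.part := by
    ext x
    simp only [Finset.mem_filter, Finset.mem_image, Finset.mem_Icc, Finset.mem_Ioc]
    constructor
    · rintro ⟨⟨k, hk, rfl⟩, hlt⟩
      refine ⟨k, ⟨?_, hk.2⟩, rfl⟩
      by_contra hc
      rcases eq_or_lt_of_le (not_lt.mp hc) with rfl | h'
      · exact lt_irrefl _ hlt
      · have := lam.part_lt_part hk.1 h' hk.2; omega
    · rintro ⟨k, hk, rfl⟩
      exact ⟨⟨k, by omega, rfl⟩, lam.part_lt_part hi'.1 hk.1 hi'.2⟩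
  have hsub : ∀ k ∈ Finset.Ioc i lam.length,
      ((lam.part i - lam.part k : ℕ) : ℚ) = (lam.part i : ℚ) - lam.part k ∧
      (lam.part i : ℚ) - lam.part k ≠ 0 := by
    intro k hk
    rw [Finset.mem_Ioc] at hk
    have := lam.part_lt_part hi'.1 hk.1 hi'.2
    refine ⟨Nat.cast_sub this.le, sub_ne_zero.mpr ?_⟩
    exact_mod_cast this.ne'
  rw [hfil, Finset.prod_image (lam.injOn_part.mono fun k hk => by
    rw [Finset.mem_coe, Finset.mem_Ioc] at hk; exact Finset.mem_Icc.mpr (by omega)),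
    Finset.prod_div_distrib, ← mul_div_assoc, eq_div_iff
      (Finset.prod_ne_zero_iff.mpr fun k hk => (hsub k hk).2)]
  have h' := congrArg (Nat.cast : ℕ → ℚ) h
  push_cast at h'
  rw [Finset.prod_congr rfl fun k hk => (hsub k hk).1] at h'
  exact h'

theorem hookProd_pos (lam : StrictPartition) : 0 < lam.hookProd :=
  Finset.prod_pos fun b _ => by unfold hook; omega

/-- The absolute value makes the factor of a pair symmetric, so the position of a among the elements
of R does not matter. -/
theorem schurProd_insert {a : ℕ} {R : Finset ℕ} (ha : a ∉ R) :
    schurProd (insert a R) =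
      schurProd R * (a.factorial * ∏ b ∈ R, ((a : ℚ) + b) / |(a : ℚ) - b|) := by
  unfold schurProd
  rw [Finset.prod_insert ha]
  have h1 : (insert a R).filter (· < a) = R.filter (· < a) := by
    rw [Finset.filter_insert, if_neg (lt_irrefl a)]
  have h2 : ∀ c ∈ R, ((c.factorial : ℚ) * ∏ b ∈ (insert a R).filter (· < c),
      ((c : ℚ) + b) / (c - b)) = ((c.factorial : ℚ) * ∏ b ∈ R.filter (· < c),
      ((c : ℚ) + b) / (c - b)) * (if c < a then 1 else ((a : ℚ) + c) / |(a : ℚ) - c|) := by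
    intro c hc
    have hne : c ≠ a := fun e => ha (e ▸ hc)
    rw [Finset.filter_insert]
    by_cases hac : a < c
    · rw [if_pos hac, if_neg (by omega), Finset.prod_insert fun h => ha (Finset.mem_filter.mp h).1,
        abs_of_neg (sub_neg.mpr (by exact_mod_cast hac)), neg_sub, add_comm (a : ℚ) c]
      ring
    · rw [if_neg hac, if_pos (by omega), mul_one]
  have h3 : ∏ b ∈ R, ((a : ℚ) + b) / |(a : ℚ) - b| =
      (∏ b ∈ R.filter (· < a), ((a : ℚ) + b) / (a - b)) *
        ∏ c ∈ R, (if c < a then 1 else ((a : ℚ) + c) / |(a : ℚ) - c|) := by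
    rw [Finset.prod_filter, ← Finset.prod_mul_distrib]
    refine Finset.prod_congr rfl fun b _ => ?_
    split_ifs with h
    · rw [abs_of_pos (sub_pos.mpr (by exact_mod_cast h)), mul_one]
    · rw [one_mul]
  rw [h1, Finset.prod_congr rfl h2, Finset.prod_mul_distrib, h3]
  ring

theorem schurProd_ne_zero (P : Finset ℕ) : schurProd P ≠ 0 := by
  unfold schurProd
  refine Finset.prod_ne_zero_iff.mpr fun a _ => mul_ne_zero (by positivity)
    (Finset.prod_ne_zero_iff.mpr fun b hb => ?_)
  have h : b < a := (Finset.mem_filter.mp hb).2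
  have h' : (b : ℚ) < a := by exact_mod_cast h
  have h0 : (0 : ℚ) ≤ b := by positivity
  exact div_ne_zero (by linarith) (by linarith)

/-! ### Quotients of hook products as residues -/

theorem tri_sub_tri (a b : ℕ) : tri (a + 1) - tri b = ((a : ℚ) + b) * (a + 1 - b) / 2 := by
  simp only [tri_eq]; push_cast; ring

theorem tri_sub_tri_succ (a b : ℕ) :
    tri (a + 1) - tri (b + 1) = ((a : ℚ) - b) * (a + 1 + b) / 2 := by
  simp only [tri_eq]; push_cast; ring

/-- The weights `∏ (x_a - y_b) / ∏ (x_a - x_c)` of the difference operator. -/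
def weight (P : Finset ℕ) (a : ℕ) : ℚ :=
  (∏ b ∈ P, (tri (a + 1) - tri b)) / ∏ c ∈ (insert 0 P).erase a, (tri (a + 1) - tri (c + 1))

/-- This allows sums over the addable rows to be extended to all of `insert 0 P`. -/
theorem weight_eq_zero {P : Finset ℕ} {a : ℕ} (h : a + 1 ∈ P) : weight P a = 0 := by
  rw [weight, Finset.prod_eq_zero h (sub_self _), zero_div]

/-- Each other part b contributes (a+b)|a+1-b| / ((a+1+b)|a-b|). The two absolute values open with
the same sign, and the factor becomes (t(a+1) - t(b)) / (t(a+1) - t(b+1)). -/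
theorem schurProd_div {P : Finset ℕ} (h0 : 0 ∉ P) {a : ℕ} (ha : a ∈ insert 0 P)
    (ha' : a + 1 ∉ P) :
    (if a = 0 then 1 else 2) * (schurProd P / schurProd (insert (a + 1) (P.erase a))) =
      weight P a := by
  set R := P.erase a with hR
  have haR : a ∉ R := Finset.notMem_erase _ _
  have ha1R : a + 1 ∉ R := fun h => ha' (Finset.mem_of_mem_erase h)
  -- For a = 0 a part 0 can be inserted freely: 0! = 1 and its factor with any b > 0 is b/b.
  have hP : schurProd P = schurProd (insert a R) := by
    rcases Finset.mem_insert.mp ha with rfl | h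
    · rw [schurProd_insert haR, hR, Finset.erase_eq_of_notMem h0, Finset.prod_eq_one, Nat.factorial]
      · simp
      · intro b hb
        have : b ≠ 0 := fun e => h0 (e ▸ hb)
        simp [this]
    · rw [hR, Finset.insert_erase h]
  have hratio : schurProd (insert a R) / schurProd (insert (a + 1) R) =
      1 / (a + 1) * ∏ b ∈ R, (tri (a + 1) - tri b) / (tri (a + 1) - tri (b + 1)) := by
    rw [schurProd_insert haR, schurProd_insert ha1R, mul_div_mul_left _ _ (schurProd_ne_zero R),
      mul_div_mul_comm, ← Finset.prod_div_distrib]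
    congr 1
    · rw [Nat.factorial_succ]; push_cast; field_simp
    · refine Finset.prod_congr rfl fun b hb => ?_
      have hb1 : b ≠ a := fun e => haR (e ▸ hb)
      have hb2 : b ≠ a + 1 := fun e => ha1R (e ▸ hb)
      rw [tri_sub_tri, tri_sub_tri_succ]
      push_cast
      have e1 : (a : ℚ) + 1 + b ≠ 0 := by positivity
      rcases lt_or_ge b a with h | h
      · have h' : (b : ℚ) < a := by exact_mod_cast h
        have e2 : (a : ℚ) - b ≠ 0 := by linarith
        have e3 : (a : ℚ) + 1 - b ≠ 0 := by linarith
        rw [abs_of_pos (by linarith), abs_of_pos (by linarith)]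
        field_simp
      · have h' : (a : ℚ) + 1 < b := by exact_mod_cast (by omega : a + 1 < b)
        have e2 : (a : ℚ) - b ≠ 0 := by linarith
        have e3 : (a : ℚ) + 1 - b ≠ 0 := by linarith
        rw [abs_of_neg (by linarith), abs_of_neg (by linarith)]
        field_simp
  rw [hP, hratio, Finset.prod_div_distrib, weight]
  rcases Finset.mem_insert.mp ha with rfl | h
  · have : R = P := Finset.erase_eq_of_notMem h0
    rw [Finset.erase_insert h0, this]
    simp
  -- The leftover factors b = a and c = 0 of the weight are a and a(a+1)/2. Their quotient 2/(a+1)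
  -- produces the coefficient 2.
  · have hne : a ≠ 0 := fun e => h0 (e ▸ h)
    have haq : (a : ℚ) ≠ 0 := by exact_mod_cast hne
    rw [if_neg hne, Finset.erase_insert_of_ne hne.symm,
      Finset.prod_insert fun h' => h0 (Finset.mem_of_mem_erase h'),
      ← Finset.mul_prod_erase P _ h, tri_sub_tri_succ a 0, tri_sub_tri a a]
    rw [← hR]
    have e1 : (a : ℚ) + 1 ≠ 0 := by positivity
    push_cast
    rw [mul_div_mul_comm, ← mul_assoc]
    congr 1
    field_simp
    ring

end StrictPartition

/-! ### Partial fractions and Newton's recursion for the moments of residues -/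

section SuperHomogeneous

open Polynomial

variable {K ι κ : Type*} [Field K] [DecidableEq ι]

/-- The residues of `∏ (z - y j) / ∏ (z - x i)`. -/
def partialFractionCoeff (S : Finset ι) (T : Finset κ) (x : ι → K) (y : κ → K) (i : ι) : K :=
  (∏ j ∈ T, (x i - y j)) / ∏ j ∈ S.erase i, (x i - x j)

/-- This is Lagrange interpolation at the x i of a polynomial of degree |T| < |S|. -/
theorem prod_sub_eq_sum_partialFractionCoeff {S : Finset ι} {T : Finset κ} {x : ι → K} {y : κ → K}
    (hx : Set.InjOn x S) (hST : T.card + 1 = S.card) (z : K) :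
    ∏ j ∈ T, (z - y j) =
      ∑ i ∈ S, partialFractionCoeff S T x y i * ∏ j ∈ S.erase i, (z - x j) := by
  have h := congrArg (Polynomial.eval z) (Lagrange.eq_interpolate (f := ∏ j ∈ T, (X - C (y j))) hx
    (by
      rw [degree_prod_of_monic _ _ fun j _ => monic_X_sub_C _, Finset.sum_congr rfl fun j _ =>
        degree_X_sub_C (y j)]
      simp only [Finset.sum_const, nsmul_eq_mul, mul_one]
      exact_mod_cast (by omega : T.card < S.card)))
  rw [Lagrange.interpolate_apply, eval_finsetSum] at h
  simp only [eval_prod, eval_sub, eval_X, eval_C, eval_mul, Lagrange.basis,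
    Lagrange.basisDivisor, Finset.prod_mul_distrib] at h
  rw [h]
  refine Finset.sum_congr rfl fun i _ => ?_
  rw [partialFractionCoeff, Finset.prod_inv_distrib, div_eq_mul_inv, mul_assoc]

/-- The reversed identity: put z = 1/t and multiply by t^|T|, for all t ≠ 0. -/
theorem prod_one_sub_eq_sum_partialFractionCoeff [Infinite K] {S : Finset ι} {T : Finset κ}
    {x : ι → K} {y : κ → K} (hx : Set.InjOn x S) (hST : T.card + 1 = S.card) :
    ∏ j ∈ T, (1 - C (y j) * X) =
      ∑ i ∈ S, C (partialFractionCoeff S T x y i) * ∏ j ∈ S.erase i, (1 - C (x j) * X) := by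
  apply eq_of_infinite_eval_eq
  refine Set.Infinite.mono (s := {t : K | t ≠ 0}) ?_ (Set.finite_singleton (0 : K)).infinite_compl
  intro t ht
  rw [Set.mem_ofPred_eq] at ht ⊢
  simp only [eval_prod, eval_sub, eval_X, eval_C, eval_mul, eval_one, eval_finsetSum]
  have hc : ∀ c : K, 1 - c * t = t * (t⁻¹ - c) := fun c => by
    rw [mul_sub, mul_inv_cancel₀ ht, mul_comm c]
  simp only [hc, Finset.prod_mul_distrib, Finset.prod_const]
  rw [prod_sub_eq_sum_partialFractionCoeff hx hST, Finset.mul_sum]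
  refine Finset.sum_congr rfl fun i hi => ?_
  rw [Finset.card_erase_of_mem hi, ← hST, Nat.add_sub_cancel]
  ring

theorem one_sub_mul_mk_pow (c : K) :
    (1 - PowerSeries.C c * PowerSeries.X) * PowerSeries.mk (fun n => c ^ n) = 1 := by
  ext n
  cases n with
  | zero => simp [sub_mul, mul_assoc]
  | succ n =>
    rw [sub_mul, one_mul, mul_assoc, map_sub, PowerSeries.coeff_C_mul,
      PowerSeries.coeff_succ_X_mul, PowerSeries.coeff_mk, PowerSeries.coeff_mk,
      PowerSeries.coeff_one, if_neg (Nat.succ_ne_zero n), pow_succ']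
    ring

theorem derivative_prod_one_sub (S : Finset ι) (x : ι → K) :
    PowerSeries.derivative K (∏ i ∈ S, (1 - PowerSeries.C (x i) * PowerSeries.X)) =
      -(∏ i ∈ S, (1 - PowerSeries.C (x i) * PowerSeries.X)) *
        ∑ i ∈ S, PowerSeries.C (x i) * PowerSeries.mk (fun n => x i ^ n) := by
  induction S using Finset.induction_on with
  | empty => simp
  | insert a S ha ih =>
    rw [Finset.prod_insert ha, Finset.sum_insert ha, Derivation.leibniz, ih]
    have h := one_sub_mul_mk_pow (x a)
    simp only [map_sub, Derivation.leibniz, smul_eq_mul, Derivation.map_one_eq_zero,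
      PowerSeries.derivative_C, PowerSeries.derivative_X]
    linear_combination (PowerSeries.C (x a) *
      ∏ i ∈ S, (1 - PowerSeries.C (x i) * PowerSeries.X)) * h

/-- The moments of the residues of `∏ (z - y j) / ∏ (z - x i)` satisfy the Newton recursion. -/
theorem newton_partialFractionCoeff [Infinite K] [DecidableEq κ] {S : Finset ι}
    {T : Finset κ}
    {x : ι → K} {y : κ → K} (hx : Set.InjOn x S) (hST : T.card + 1 = S.card) :
    ∑ i ∈ S, partialFractionCoeff S T x y i = 1 ∧
    ∀ k : ℕ, ((k : K) + 1) * ∑ i ∈ S, partialFractionCoeff S T x y i * x i ^ (k + 1) =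
      ∑ p ∈ Finset.HasAntidiagonal.antidiagonal k, (∑ i ∈ S, partialFractionCoeff S T x y i * x i ^ p.1) *
        (∑ i ∈ S, x i ^ (p.2 + 1) - ∑ j ∈ T, y j ^ (p.2 + 1)) := by
  set w := partialFractionCoeff S T x y
  set F : PowerSeries K := PowerSeries.mk fun k => ∑ i ∈ S, w i * x i ^ k with hF
  set M : PowerSeries K := ∏ i ∈ S, (1 - PowerSeries.C (x i) * PowerSeries.X) with hM
  set N : PowerSeries K := ∏ j ∈ T, (1 - PowerSeries.C (y j) * PowerSeries.X) with hN
  have hFsum : F = ∑ i ∈ S, PowerSeries.C (w i) * PowerSeries.mk (fun k => x i ^ k) := by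
    ext k
    simp [hF]
  -- The generating function of the moments is N / M, since each w i / (1 - x i X) is a geometric
  -- series.
  have hMF : M * F = N := by
    have h := congrArg (Polynomial.coeToPowerSeries.ringHom (R := K))
      (prod_one_sub_eq_sum_partialFractionCoeff (y := y) hx hST)
    simp only [map_sum, map_prod, map_mul, map_sub, map_one,
      Polynomial.coeToPowerSeries.ringHom_apply, Polynomial.coe_C, Polynomial.coe_X] at h
    rw [hN, h, hFsum, Finset.mul_sum]
    refine Finset.sum_congr rfl fun i hi => ?_
    rw [hM, ← Finset.mul_prod_erase _ _ hi]
    linear_combination (PowerSeries.C (w i) *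
      ∏ j ∈ S.erase i, (1 - PowerSeries.C (x j) * PowerSeries.X)) * one_sub_mul_mk_pow (x i)
  have hM0 : PowerSeries.constantCoeff M = 1 := by simp [hM, map_prod]
  have hN0 : PowerSeries.constantCoeff N = 1 := by simp [hN, map_prod]
  have hF0 : PowerSeries.constantCoeff F = 1 := by
    have := congrArg PowerSeries.constantCoeff hMF
    rwa [map_mul, hM0, hN0, one_mul] at this
  refine ⟨by simpa [hF] using hF0, fun k => ?_⟩
  have hne : M ≠ 0 := by
    intro h
    rw [h, map_zero] at hM0
    exact zero_ne_one hM0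
  have hd := congrArg (PowerSeries.derivative K) hMF
  rw [Derivation.leibniz, smul_eq_mul, smul_eq_mul, derivative_prod_one_sub,
    derivative_prod_one_sub, ← hM, ← hN, ← hMF] at hd
  -- Logarithmic differentiation: F'/F = N'/N - M'/M, and these quotients generate the power sums.
  have hF' : PowerSeries.derivative K F = F *
      (∑ i ∈ S, PowerSeries.C (x i) * PowerSeries.mk (fun n => x i ^ n) -
        ∑ j ∈ T, PowerSeries.C (y j) * PowerSeries.mk (fun n => y j ^ n)) := by
    apply mul_left_cancel₀ hne
    linear_combination hd
  have hk := congrArg (PowerSeries.coeff k) hF'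
  rw [PowerSeries.coeff_derivative, PowerSeries.coeff_mul] at hk
  simp only [hF, PowerSeries.coeff_mk, map_sub, map_sum, PowerSeries.coeff_C_mul] at hk
  rw [mul_comm, hk]
  refine Finset.sum_congr rfl fun p _ => ?_
  simp only [pow_succ']

end SuperHomogeneous

/-! ### Moments and shifted averages in the filtration by |δ| -/

namespace StrictPartition

/-- The moments of the weights of the difference operator. -/
def moment (k : ℕ) (lam : StrictPartition) : ℚ :=
  ∑ a ∈ insert 0 lam.partSet, weight lam.partSet a * tri (a + 1) ^ k

theorem tri_succ_injective : Function.Injective fun a => tri (a + 1) := by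
  apply StrictMono.injective
  apply strictMono_nat_of_lt_succ
  intro a
  simp only [tri_eq]
  push_cast
  have : (0 : ℚ) ≤ a := by positivity
  nlinarith

/-- The nodes t(a+1) for a ∈ P ∪ {0} and t(a) for a ∈ P have q_k as difference of power sums for k ≥
1, because the node t(1) is 0. -/
theorem newton_moment (lam : StrictPartition) : moment 0 lam = 1 ∧
    ∀ k : ℕ, ((k : ℚ) + 1) * moment (k + 1) lam =
      ∑ p ∈ Finset.HasAntidiagonal.antidiagonal k, moment p.1 lam * q (p.2 + 1) lam := by
  obtain ⟨h0, h1⟩ := newton_partialFractionCoeff (S := insert 0 lam.partSet) (T := lam.partSet)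
    (x := fun a => tri (a + 1)) (y := tri) tri_succ_injective.injOn
    (Finset.card_insert_of_notMem lam.zero_notMem_partSet).symm
  refine ⟨?_, fun k => ?_⟩
  · simp only [moment, pow_zero, mul_one]
    exact h0
  · refine (h1 k).trans (Finset.sum_congr rfl fun p _ => ?_)
    have hq : q (p.2 + 1) lam = ∑ a ∈ insert 0 lam.partSet, tri (a + 1) ^ (p.2 + 1) -
        ∑ a ∈ lam.partSet, tri a ^ (p.2 + 1) := by
      rw [q_eq, Finset.sum_insert lam.zero_notMem_partSet, Finset.sum_sub_distrib, add_sub_assoc,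
        zero_add, show tri 1 = 0 by simp [tri]]
    rw [hq]
    rfl

/-- The span of the functions `q_δ` with `|δ| < n`. -/
noncomputable def qSpan (n : ℕ) : Submodule ℚ (StrictPartition → ℚ) :=
  Submodule.span ℚ (Set.range fun x : (Σ d : Fin n, (d : ℕ).Partition) => qPartition x.2)

theorem qPartition_mem_qSpan {d n : ℕ} (h : d < n) (δ : d.Partition) : qPartition δ ∈ qSpan n :=
  Submodule.subset_span ⟨⟨⟨d, h⟩, δ⟩, rfl⟩

theorem qSpan_mono {m n : ℕ} (h : m ≤ n) : qSpan m ≤ qSpan n := by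
  refine Submodule.span_le.mpr ?_
  rintro _ ⟨⟨d, δ⟩, rfl⟩
  exact qPartition_mem_qSpan (d.2.trans_le h) δ

/-- Products of generators come from uniting the multisets of parts. The bounds are strict, so sizes
at most m and below n add up to less than m + n. -/
theorem mul_mem_qSpan {m n : ℕ} {f g : StrictPartition → ℚ} (hf : f ∈ qSpan (m + 1))
    (hg : g ∈ qSpan n) : f * g ∈ qSpan (m + n) := by
  have h := Submodule.mul_mem_mul hf hg
  rw [qSpan, qSpan, Submodule.span_mul_span] at h
  refine Submodule.span_le.mpr ?_ h
  rintro _ ⟨_, ⟨⟨d, δ⟩, rfl⟩, _, ⟨⟨e, ε⟩, rfl⟩, rfl⟩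
  have hde : (d : ℕ) + e < m + n := by have := d.2; have := e.2; omega
  have := qPartition_mem_qSpan hde
    { parts := δ.parts + ε.parts
      parts_pos := fun {i} hi => (Multiset.mem_add.mp hi).elim (fun h => δ.parts_pos h)
        fun h => ε.parts_pos h
      parts_sum := by rw [Multiset.sum_add, δ.parts_sum, ε.parts_sum] }
  refine Set.mem_of_eq_of_mem (funext fun lam => ?_) this
  simp [qPartition]

theorem one_mem_qSpan {n : ℕ} (hn : 0 < n) : (1 : StrictPartition → ℚ) ∈ qSpan n := by
  have := qPartition_mem_qSpan hn ⟨0, by simp, by simp⟩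
  refine Set.mem_of_eq_of_mem (funext fun lam => ?_) this
  simp [qPartition]

theorem q_zero : q 0 = 1 := by
  ext lam
  simp [q_eq]

theorem q_mem_qSpan (k : ℕ) : q k ∈ qSpan (k + 1) := by
  rcases Nat.eq_zero_or_pos k with rfl | hk
  · rw [q_zero]
    exact one_mem_qSpan one_pos
  · have := qPartition_mem_qSpan (Nat.lt_add_one k) ⟨{k}, by simpa using hk, by simp⟩
    refine Set.mem_of_eq_of_mem (funext fun lam => ?_) this
    simp [qPartition]

theorem moment_mem_qSpan (k : ℕ) : moment k ∈ qSpan (k + 1) := by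
  induction k using Nat.strong_induction_on with
  | _ k ih =>
    cases k with
    | zero =>
      rw [show moment 0 = 1 from funext fun lam => lam.newton_moment.1]
      exact one_mem_qSpan one_pos
    | succ k =>
      have h : moment (k + 1) = ((k : ℚ) + 1)⁻¹ •
          ∑ p ∈ Finset.HasAntidiagonal.antidiagonal k, moment p.1 * q (p.2 + 1) := by
        ext lam
        have := lam.newton_moment.2 k
        have hk : (k : ℚ) + 1 ≠ 0 := by positivity
        rw [Pi.smul_apply, Finset.sum_apply, smul_eq_mul, eq_inv_mul_iff_mul_eq₀ hk]
        exact this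
      rw [h]
      refine Submodule.smul_mem _ _ (Submodule.sum_mem _ fun p hp => ?_)
      have hp' := Finset.HasAntidiagonal.mem_antidiagonal.mp hp
      refine qSpan_mono ?_ (mul_mem_qSpan (ih p.1 (by omega)) (q_mem_qSpan (p.2 + 1)))
      omega

/-- The weighted average of `p` times the product of the shifted `q_k`. -/
noncomputable def shiftedAverage (s : Multiset ℕ) (p : Polynomial ℚ) (lam : StrictPartition) : ℚ :=
  ∑ a ∈ insert 0 lam.partSet, weight lam.partSet a * (p.eval (tri (a + 1)) *
    (s.map fun k => q k lam + (qStep k).eval (tri (a + 1))).prod)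

theorem shiftedAverage_cons (k : ℕ) (s : Multiset ℕ) (p : Polynomial ℚ) :
    shiftedAverage (k ::ₘ s) p = q k * shiftedAverage s p + shiftedAverage s (p * qStep k) := by
  ext lam
  simp only [shiftedAverage, Pi.add_apply, Pi.mul_apply, Multiset.map_cons, Multiset.prod_cons,
    Polynomial.eval_mul, Finset.mul_sum, ← Finset.sum_add_distrib]
  exact Finset.sum_congr rfl fun a _ => by ring

/-- Expanding one factor either pulls out q_k or moves the shift, of degree below k, into p. Neither
raises the total weight, and the moments remain at the end. -/
theorem shiftedAverage_mem_qSpan (s : Multiset ℕ) {p : Polynomial ℚ} {d : ℕ}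
    (hp : p ∈ Polynomial.degreeLT ℚ d) : shiftedAverage s p ∈ qSpan (s.sum + d) := by
  induction s using Multiset.induction_on generalizing p d with
  | empty =>
    have h : shiftedAverage 0 p = ∑ j ∈ Finset.range d, p.coeff j • moment j := by
      ext lam
      simp only [shiftedAverage, Multiset.map_zero, Multiset.prod_zero, mul_one, Finset.sum_apply,
        Pi.smul_apply, moment, smul_eq_mul, Finset.mul_sum]
      rw [Finset.sum_comm]
      refine Finset.sum_congr rfl fun a _ => ?_
      rw [Polynomial.eval_eq_sum_degreeLTEquiv hp, Finset.sum_range, Finset.mul_sum]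
      exact Finset.sum_congr rfl fun i _ => mul_left_comm _ _ _
    rw [h, Multiset.sum_zero, zero_add]
    exact Submodule.sum_mem _ fun j hj => Submodule.smul_mem _ _
      (qSpan_mono (Finset.mem_range.mp hj) (moment_mem_qSpan j))
  | cons k s ih =>
    rw [shiftedAverage_cons, Multiset.sum_cons, add_assoc]
    refine Submodule.add_mem _ (mul_mem_qSpan (q_mem_qSpan k) (ih hp)) ?_
    refine qSpan_mono (m := s.sum + (d + k)) (by omega) (ih ?_)
    rw [Polynomial.mem_degreeLT] at hp ⊢
    by_cases h0 : qStep k = 0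
    · simp [h0]
    rw [Polynomial.degree_mul, Nat.cast_add]
    exact WithBot.add_lt_add_of_lt_of_le (mt Polynomial.degree_eq_bot.mp h0) hp
      (degree_qStep k).1.le

/-- The drop in weight: the unshifted product has coefficient `moment 0` = 1 and cancels, and every
other term contains some `qStep k`, of degree below k. -/
theorem shiftedAverage_one_sub_mem_qSpan (s : Multiset ℕ) :
    shiftedAverage s 1 - (fun lam => (s.map fun k => q k lam).prod) ∈ qSpan s.sum := by
  induction s using Multiset.induction_on with
  | empty =>
    refine Set.mem_of_eq_of_mem (funext fun lam => ?_) (Submodule.zero_mem _)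
    have := lam.newton_moment.1
    simp only [moment, pow_zero, mul_one] at this
    simp only [shiftedAverage, Polynomial.eval_one, Multiset.map_zero, Multiset.prod_zero, mul_one,
      Pi.sub_apply, Pi.zero_apply, this, sub_self]
  | cons k s ih =>
    have h : shiftedAverage (k ::ₘ s) 1 - (fun lam => ((k ::ₘ s).map fun k => q k lam).prod) =
        q k * (shiftedAverage s 1 - fun lam => (s.map fun k => q k lam).prod) +
          shiftedAverage s (qStep k) := by
      rw [shiftedAverage_cons, one_mul]
      ext lam
      simp only [Pi.sub_apply, Pi.add_apply, Pi.mul_apply, Multiset.map_cons, Multiset.prod_cons]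
      ring
    rw [h, Multiset.sum_cons]
    refine Submodule.add_mem _ (mul_mem_qSpan (q_mem_qSpan k) ih) ?_
    rw [add_comm]
    exact shiftedAverage_mem_qSpan s (Polynomial.mem_degreeLT.mpr (degree_qStep k).1)

theorem exists_eq_sum_of_mem_qSpan {n : ℕ} {f : StrictPartition → ℚ} (hf : f ∈ qSpan n) :
    ∃ xi : (d : ℕ) → d.Partition → ℚ, ∀ lam,
      f lam = ∑ d ∈ Finset.range n, ∑ δ : d.Partition, xi d δ * qPartition δ lam := by
  obtain ⟨c, rfl⟩ := (Submodule.mem_span_range_iff_exists_fun ℚ).mp hf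
  refine ⟨fun d δ => if h : d < n then c ⟨⟨d, h⟩, δ⟩ else 0, fun lam => ?_⟩
  rw [Finset.sum_range, Finset.sum_apply, Fintype.sum_sigma]
  refine Finset.sum_congr rfl fun d _ => Finset.sum_congr rfl fun δ _ => ?_
  simp

/-! ### The operator D as a weighted average -/

theorem mem_plus (lam mu : StrictPartition) : mu ∈ lam.plus ↔ ∃ r, AddAt lam mu r := by
  rw [plus, Set.Finite.mem_toFinset]
  exact ⟨fun h => h.exists_addAt, fun ⟨_, h⟩ => h.isPlus⟩

/-- Summation over the ways to add a box. -/
theorem sum_plus (lam : StrictPartition) (F : StrictPartition → ℚ) (G : ℕ → ℚ)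
    (h : ∀ mu r, AddAt lam mu r → F mu = G (lam.part r)) :
    ∑ mu ∈ lam.plus, F mu = ∑ a ∈ insert 0 lam.partSet with a + 1 ∉ lam.partSet, G a := by
  choose! row hrow using fun mu => (lam.mem_plus mu).mp
  refine Finset.sum_bij (fun mu _ => lam.part (row mu)) ?_ ?_ ?_ ?_
  · intro mu hmu
    exact Finset.mem_filter.mpr ⟨(hrow mu hmu).mem_insert_zero, (hrow mu hmu).succ_notMem⟩
  · intro mu hmu mu' hmu' e
    apply partSet_injective
    rw [(hrow mu hmu).partSet_eq, (hrow mu' hmu').partSet_eq, e]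
  · intro a ha
    rw [Finset.mem_filter] at ha
    obtain ⟨mu, r, hr, rfl⟩ := lam.exists_addAt ha.1 ha.2
    have hmu := (lam.mem_plus mu).mpr ⟨r, hr⟩
    exact ⟨mu, hmu, by rw [hr.unique (hrow mu hmu)]⟩
  · intro mu hmu
    exact h mu _ (hrow mu hmu)

theorem D_eq_sum (g : StrictPartition → ℚ) (lam : StrictPartition) :
    D g lam = ∑ mu ∈ lam.plus, (if lam.length < mu.length then 1 else 2) * g mu - g lam := by
  have h : lam.plus.filter (fun mu => mu.length = lam.length) =
      lam.plus.filter fun mu => ¬ lam.length < mu.length := by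
    refine Finset.filter_congr fun mu hmu => ?_
    obtain ⟨r, hr⟩ := (lam.mem_plus mu).mp hmu
    rw [hr.length_eq]
    split_ifs <;> omega
  rw [D, h, Finset.sum_filter, Finset.sum_filter, Finset.mul_sum, ← Finset.sum_add_distrib]
  congr 1
  refine Finset.sum_congr rfl fun mu _ => ?_
  split_ifs <;> ring

theorem D_qPartition_div {n : ℕ} (nu : n.Partition) (lam : StrictPartition) :
    D (fun mu => qPartition nu mu / (mu.hookProd : ℚ)) lam =
      (shiftedAverage nu.parts 1 - qPartition nu) lam / (lam.hookProd : ℚ) := by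
  have hH : (lam.hookProd : ℚ) ≠ 0 := by exact_mod_cast lam.hookProd_pos.ne'
  rw [D_eq_sum, Pi.sub_apply, sub_div]
  congr 1
  rw [lam.sum_plus _ (fun a => weight lam.partSet a * ((nu.parts.map fun k =>
    q k lam + (qStep k).eval (tri (a + 1))).prod) / lam.hookProd), Finset.sum_filter_of_ne,
    shiftedAverage, Finset.sum_div]
  · simp
  -- Rows that cannot be extended have weight zero, so the restriction on a can be dropped.
  · intro a _ hne hmem
    rw [weight_eq_zero hmem] at hne
    simp at hne
  · intro mu r hr
    have hw := schurProd_div lam.zero_notMem_partSet hr.mem_insert_zero hr.succ_notMem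
    rw [← hr.partSet_eq, ← hookProd_eq, ← hookProd_eq] at hw
    have hif : (if lam.length < mu.length then (1 : ℚ) else 2) =
        if lam.part r = 0 then 1 else 2 := by
      rw [hr.length_eq]
      by_cases h0 : lam.part r = 0 <;> simp [h0]
    have hmu : (mu.hookProd : ℚ) ≠ 0 := by exact_mod_cast mu.hookProd_pos.ne'
    rw [hif, ← hw]
    simp only [qPartition, hr.q_eq]
    field_simp

end StrictPartition

theorem mainTheorem10 :
    (∀ (n : ℕ) (nu : n.Partition),
      ∃ xi : (d : ℕ) → d.Partition → ℚ, ∀ lam : StrictPartition,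
        StrictPartition.D
            (fun mu => StrictPartition.qPartition nu mu / (mu.hookProd : ℚ)) lam =
          ∑ d ∈ Finset.range n, ∑ delta : d.Partition,
            xi d delta * (StrictPartition.qPartition delta lam / (lam.hookProd : ℚ))) ∧
    (∀ k : ℕ, ∃ xi : ℕ → ℚ, ∀ (lam mu : StrictPartition) (b : ℕ × ℕ),
      b ∉ lam.diagram → mu.diagram = insert b lam.diagram →
        StrictPartition.q k mu - StrictPartition.q k lam =
          ∑ j ∈ Finset.range k, xi j * ((StrictPartition.content b).choose 2 : ℚ) ^ j) := by
  refine ⟨fun n nu => ?_, StrictPartition.exists_q_sub_eq⟩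
  have h := StrictPartition.shiftedAverage_one_sub_mem_qSpan nu.parts
  rw [nu.parts_sum] at h
  obtain ⟨xi, hxi⟩ := StrictPartition.exists_eq_sum_of_mem_qSpan h
  refine ⟨xi, fun lam => ?_⟩
  rw [StrictPartition.D_qPartition_div, show StrictPartition.qPartition nu =
    fun lam => (nu.parts.map fun k => StrictPartition.q k lam).prod from rfl, hxi lam,
    Finset.sum_div]
  refine Finset.sum_congr rfl fun d _ => ?_
  rw [Finset.sum_div]
  exact Finset.sum_congr rfl fun δ _ => mul_div_assoc _ _ _
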